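/- Let $(X,d,\mu)$ be a complete metric space equipped with a Borel measure $\mu$ that is doubling with constant $C_d>0$, that is, $0<\mu(B(x,2r))\le C_d\,\mu(B(x,r))<\infty$ for all $x\in X$ and $r>0$. For $A\subset X$ let $$\mathcal H(A)=\lim_{R\to 0^+}\inf\Big\{\sum_{i}\frac{\mu(B(x_i,r_i))}{r_i}:\ A\subset\bigcup_{i}B(x_i,r_i),\ 0<r_i\le R\Big\}$$ (finite or countable covers) be the codimension $1$ Hausdorff measure. For an open set $\Omega\subset X$ and $u\in L^1(\Omega)$ let $$\|Du\|(\Omega)=\inf\Big\{\liminf_{i\to\infty}\int_\Omega g_i\,d\mu:\ u_i\in \mathrm{Lip}_{\rm loc}(\Omega),\ u_i\to u\text{ in }L^1_{\rm loc}(\Omega),\ g_i\text{ an upper gradient of }u_i\text{ in }\Omega\Big\}.$$ Here "loc" refers to open sets whose closure is a compact subset of $\Omega$, and a Borel function $g\ge 0$ is an upper gradient of $v$ in $\Omega$ if $|v(x)-v(y)|\le\int_\gamma g\,ds$ for every rectifiable curve $\gamma$ in $\Omega$ with end points $x,y$. Let $\mathrm{BV}(\Omega)$ be the set of $u\in L^1(\Omega)$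 with $\|Du\|(\Omega)<\infty$. A function $Tu:\partial\Omega\to\mathbb R$ is the trace of $u$ if for $\mathcal H$-almost every $x\in\partial\Omega$ $$\lim_{r\to0^+}\frac1{\mu(\Omega\cap B(x,r))}\int_{\Omega\cap B(x,r)}|u-Tu(x)|\,d\mu=0 .$$ **Proposition.** Let $\Omega\subset X$ be open and bounded, and let $C_T>0$. Suppose that every $u\in\mathrm{BV}(\Omega)$ has a trace $Tu$ and that $$\int_{\partial\Omega}|Tu|\,d\mathcal H\le C_T\Big(\int_\Omega|u|\,d\mu+\|Du\|(\Omega)\Big)\qquad\text{for every }u\in\mathrm{BV}(\Omega).$$ Then there is a constant $C>0$, depending only on $C_T$, $C_d$ and $\operatorname{diam}(\Omega)$, such that $$\mathcal H(B(x,r)\cap\partial\Omega)\le C\,\frac{\mu(B(x,r))}{r}\qquad\text{for all }x\in\partial\Omega\text{ and all }0<r<2\operatorname{diam}(\Omega).$$ -/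

import Mathlib

open MeasureTheory Set Filter Topology
open scoped ENNReal NNReal

namespace MetricBV

section Hausdorff

variable {X : Type*} [MetricSpace X] [MeasurableSpace X]

/-- `μ` is doubling with constant `Cd`: `0 < μ(B(x,2r)) ≤ Cd μ(B(x,r)) < ∞` for all balls. -/
def IsDoublingWith (μ : Measure X) (Cd : ℝ) : Prop :=
  ∀ (x : X) (r : ℝ), 0 < r →
    0 < μ (Metric.ball x (2 * r)) ∧
      μ (Metric.ball x (2 * r)) ≤ ENNReal.ofReal Cd * μ (Metric.ball x r) ∧
      ENNReal.ofReal Cd * μ (Metric.ball x r) < ∞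

/-- The quantity `μ(B(x,r)) / r` of the ball with centre `p.1` and radius `p.2`. -/
noncomputable def ballWeight (μ : Measure X) (p : X × ℝ) : ℝ≥0∞ :=
  μ (Metric.ball p.1 p.2) / ENNReal.ofReal p.2

/-- `S` is a (finite or) countable family of balls of positive radius at most `R` covering `A`. -/
def IsBallCover (R : ℝ) (A : Set X) (S : Set (X × ℝ)) : Prop :=
  S.Countable ∧ (∀ p ∈ S, 0 < p.2 ∧ p.2 ≤ R) ∧ A ⊆ ⋃ p ∈ S, Metric.ball p.1 p.2

/-- The restricted spherical Hausdorff content of codimension `1`. -/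
noncomputable def hausdorffContent (μ : Measure X) (R : ℝ) (A : Set X) : ℝ≥0∞ :=
  ⨅ (S : Set (X × ℝ)) (_ : IsBallCover R A S), ∑' p : S, ballWeight μ p

theorem hausdorffContent_mono (μ : Measure X) (R : ℝ) {A B : Set X} (h : A ⊆ B) :
    hausdorffContent μ R A ≤ hausdorffContent μ R B :=
  le_iInf₂ fun S hS => iInf₂_le S ⟨hS.1, hS.2.1, h.trans hS.2.2⟩

theorem hausdorffContent_anti (μ : Measure X) {R R' : ℝ} (h : R ≤ R') (A : Set X) :
    hausdorffContent μ R' A ≤ hausdorffContent μ R A :=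
  le_iInf₂ fun S hS => iInf₂_le S
    ⟨hS.1, fun p hp => ⟨(hS.2.1 p hp).1, (hS.2.1 p hp).2.trans h⟩, hS.2.2⟩

theorem hausdorffContent_empty (μ : Measure X) (R : ℝ) :
    hausdorffContent μ R (∅ : Set X) = 0 := by
  refine le_antisymm ?_ bot_le
  refine (iInf₂_le (∅ : Set (X × ℝ)) ⟨countable_empty, by simp, by simp⟩).trans ?_
  simp

theorem hausdorffContent_iUnion (μ : Measure X) (R : ℝ) (A : ℕ → Set X) :
    hausdorffContent μ R (⋃ i, A i) ≤ ∑' i, hausdorffContent μ R (A i) := by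
  refine ENNReal.le_of_forall_pos_le_add fun ε hε hfin => ?_
  obtain ⟨δ, hδ, hsum⟩ := ENNReal.exists_pos_sum_of_countable (ENNReal.coe_pos.2 hε).ne' ℕ
  have key : ∀ i, ∃ S, IsBallCover R (A i) S ∧
      ∑' p : S, ballWeight μ p < hausdorffContent μ R (A i) + δ i := by
    intro i
    have h1 : hausdorffContent μ R (A i) ≠ ∞ := ENNReal.ne_top_of_tsum_ne_top hfin.ne i
    have h2 : hausdorffContent μ R (A i) < hausdorffContent μ R (A i) + δ i :=
      ENNReal.lt_add_right h1 (ENNReal.coe_pos.2 (hδ i)).ne'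
    conv_lhs at h2 => rw [hausdorffContent]
    simpa only [iInf_lt_iff, exists_prop] using h2
  choose S hS hlt using key
  have hcov : IsBallCover R (⋃ i, A i) (⋃ i, S i) := by
    refine ⟨countable_iUnion fun i => (hS i).1, ?_, ?_⟩
    · intro p hp
      obtain ⟨i, hi⟩ := mem_iUnion.1 hp
      exact (hS i).2.1 p hi
    · refine iUnion_subset fun i => (hS i).2.2.trans ?_
      exact biUnion_subset_biUnion_left (subset_iUnion S i)
  calc hausdorffContent μ R (⋃ i, A i)
      ≤ ∑' p : (⋃ i, S i : Set (X × ℝ)), ballWeight μ p := iInf₂_le _ hcov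
    _ ≤ ∑' i, ∑' p : S i, ballWeight μ p := ENNReal.tsum_iUnion_le_tsum _ _
    _ ≤ ∑' i, (hausdorffContent μ R (A i) + δ i) := ENNReal.tsum_le_tsum fun i => (hlt i).le
    _ = ∑' i, hausdorffContent μ R (A i) + ∑' i, (δ i : ℝ≥0∞) := ENNReal.tsum_add
    _ ≤ _ := by gcongr

/-- The codimension `1` Hausdorff measure as an outer measure. The contents increase as `R`
decreases, so that the limit as `R → 0` is the supremum over `R > 0`. -/
noncomputable def hausdorffOuter (μ : Measure X) : OuterMeasure X where
  measureOf A := ⨆ (R : ℝ) (_ : 0 < R), hausdorffContent μ R A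
  empty := by simp [hausdorffContent_empty]
  mono h := iSup₂_mono fun R _ => hausdorffContent_mono μ R h
  iUnion_nat A _ := iSup₂_le fun R hR => (hausdorffContent_iUnion μ R A).trans <|
    ENNReal.tsum_le_tsum fun i => le_iSup₂ (f := fun (R : ℝ) (_ : 0 < R) =>
      hausdorffContent μ R (A i)) R hR

theorem hausdorffOuter_apply (μ : Measure X) (A : Set X) :
    hausdorffOuter μ A = ⨆ (R : ℝ) (_ : 0 < R), hausdorffContent μ R A := rfl

theorem tendsto_hausdorffContent (μ : Measure X) (A : Set X) :
    Tendsto (fun R => hausdorffContent μ R A) (𝓝[>] 0) (𝓝 (hausdorffOuter μ A)) := by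
  refine tendsto_order.2 ⟨fun a ha => ?_, fun a ha => ?_⟩
  · rw [hausdorffOuter_apply] at ha
    simp only [lt_iSup_iff, exists_prop] at ha
    obtain ⟨R, hR, h⟩ := ha
    filter_upwards [Ioo_mem_nhdsGT hR] with R' hR'
    exact h.trans_le (hausdorffContent_anti μ hR'.2.le A)
  · filter_upwards [self_mem_nhdsWithin] with R hR
    exact lt_of_le_of_lt (le_iSup₂ (f := fun (R : ℝ) (_ : 0 < R) =>
      hausdorffContent μ R A) R hR) ha

theorem hausdorffContent_add_le (μ : Measure X) {R ε : ℝ} (hR : 2 * R ≤ ε) {A B : Set X}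
    (h : ∀ x ∈ A, ∀ y ∈ B, ε ≤ dist x y) :
    hausdorffContent μ R A + hausdorffContent μ R B ≤ hausdorffContent μ R (A ∪ B) := by
  refine le_iInf₂ fun S hS => ?_
  let SA : Set (X × ℝ) := {p ∈ S | (Metric.ball p.1 p.2 ∩ A).Nonempty}
  let SB : Set (X × ℝ) := {p ∈ S | (Metric.ball p.1 p.2 ∩ B).Nonempty}
  have hdisj : Disjoint SA SB := by
    refine Set.disjoint_left.2 ?_
    rintro p ⟨hp, x, hx, hxA⟩ ⟨-, y, hy, hyB⟩
    have h1 := h x hxA y hyB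
    have h2 := dist_triangle_right x y p.1
    have h3 := (hS.2.1 p hp).2
    rw [Metric.mem_ball] at hx hy
    linarith
  have sub : ∀ C : Set X, C ⊆ A ∪ B →
      IsBallCover R C {p ∈ S | (Metric.ball p.1 p.2 ∩ C).Nonempty} := by
    intro C hC
    refine ⟨hS.1.mono (sep_subset _ _), fun p hp => hS.2.1 p hp.1, fun x hx => ?_⟩
    obtain ⟨p, hp, hxp⟩ := mem_iUnion₂.1 (hS.2.2 (hC hx))
    exact mem_iUnion₂.2 ⟨p, ⟨hp, x, hxp, hx⟩, hxp⟩
  calc hausdorffContent μ R A + hausdorffContent μ R B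
      ≤ ∑' p : SA, ballWeight μ p + ∑' p : SB, ballWeight μ p :=
        add_le_add (iInf₂_le SA (sub A subset_union_left))
          (iInf₂_le SB (sub B subset_union_right))
    _ = ∑' p : (SA ∪ SB : Set (X × ℝ)), ballWeight μ p :=
        (ENNReal.summable.tsum_union_disjoint hdisj ENNReal.summable).symm
    _ ≤ ∑' p : S, ballWeight μ p :=
        ENNReal.tsum_mono_subtype _ (union_subset (sep_subset _ _) (sep_subset _ _))

theorem hausdorffOuter_isMetric (μ : Measure X) : (hausdorffOuter μ).IsMetric := by
  rintro A B ⟨ε, hε, h⟩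
  refine le_antisymm (measure_union_le _ _) ?_
  obtain ⟨δ, hδ, hδε⟩ : ∃ δ : ℝ, 0 < δ ∧ ENNReal.ofReal δ ≤ ε := by
    rcases eq_or_ne ε ∞ with rfl | hε'
    · exact ⟨1, one_pos, le_top⟩
    · exact ⟨ε.toReal, ENNReal.toReal_pos hε hε', (ENNReal.ofReal_toReal hε').le⟩
  have hd : ∀ x ∈ A, ∀ y ∈ B, δ ≤ dist x y := fun x hx y hy => by
    have := hδε.trans (h x hx y hy)
    rwa [edist_dist, ENNReal.ofReal_le_ofReal_iff dist_nonneg] at this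
  have hlim := (tendsto_hausdorffContent μ A).add (tendsto_hausdorffContent μ B)
  refine le_of_tendsto hlim ?_
  filter_upwards [Ioo_mem_nhdsGT (half_pos hδ)] with R hR
  refine (hausdorffContent_add_le μ (by linarith [hR.2]) hd).trans ?_
  exact le_iSup₂ (f := fun (R : ℝ) (_ : 0 < R) => hausdorffContent μ R (A ∪ B)) R hR.1

/-- The codimension `1` Hausdorff measure, as a Borel measure. -/
noncomputable def hausdorff [BorelSpace X] (μ : Measure X) : Measure X :=
  (hausdorffOuter μ).toMeasure <|
    (BorelSpace.measurable_eq (α := X)).le.trans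
      (hausdorffOuter_isMetric μ).borel_le_caratheodory

end Hausdorff

section BV

variable {X : Type*} [MetricSpace X]

/-- `U ⋐ Ω`: `U` is open and its closure is a compact subset of `Ω`. -/
def CompactlyInside (U Ω : Set X) : Prop :=
  IsOpen U ∧ IsCompact (closure U) ∧ closure U ⊆ Ω

/-- `v ∈ Lip_loc(Ω)`: `v` is Lipschitz in every `U ⋐ Ω`. -/
def IsLipLoc (Ω : Set X) (v : X → ℝ) : Prop :=
  ∀ U, CompactlyInside U Ω → ∃ K : ℝ≥0, LipschitzOnWith K v U

/-- A curve in `Ω`: a rectifiable continuous mapping from a compact interval `[a, b]` to `Ω`. -/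
def IsCurveIn (Ω : Set X) (γ : ℝ → X) (a b : ℝ) : Prop :=
  a ≤ b ∧ ContinuousOn γ (Icc a b) ∧ BoundedVariationOn γ (Icc a b) ∧ MapsTo γ (Icc a b) Ω

/-- The curve integral `∫_γ g ds`: the integral of `g` along the arc-length parametrization of
the curve over `[0, ℓ(γ)]`. -/
noncomputable def curveIntegral (g : X → ℝ≥0∞) (γ : ℝ → X) (a b : ℝ) : ℝ≥0∞ :=
  ∫⁻ s in Icc 0 (variationOnFromTo γ (Icc a b) a b),
    g (naturalParameterization γ (Icc a b) a s)

variable [MeasurableSpace X]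

/-- `g` is an upper gradient of the real-valued function `v` in `Ω`. -/
def IsUpperGradient (Ω : Set X) (v : X → ℝ) (g : X → ℝ≥0∞) : Prop :=
  Measurable g ∧ ∀ (γ : ℝ → X) (a b : ℝ), IsCurveIn Ω γ a b →
    ENNReal.ofReal |v (γ a) - v (γ b)| ≤ curveIntegral g γ a b

/-- `v i → u` in `L¹_loc(Ω)`. -/
def TendstoL1Loc (μ : Measure X) (Ω : Set X) (v : ℕ → X → ℝ) (u : X → ℝ) : Prop :=
  ∀ U, CompactlyInside U Ω → Tendsto (fun i => ∫⁻ x in U, ‖v i x - u x‖ₑ ∂μ) atTop (𝓝 0)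

/-- The total variation `‖Du‖(Ω)`. -/
noncomputable def totalVariation (μ : Measure X) (Ω : Set X) (u : X → ℝ) : ℝ≥0∞ :=
  ⨅ (v : ℕ → X → ℝ) (g : ℕ → X → ℝ≥0∞) (_ : ∀ i, IsLipLoc Ω (v i))
    (_ : ∀ i, IsUpperGradient Ω (v i) (g i)) (_ : TendstoL1Loc μ Ω v u),
    liminf (fun i => ∫⁻ x in Ω, g i x ∂μ) atTop

/-- `u ∈ BV(Ω)`; only the values of `u` in `Ω` matter. -/
def MemBV (μ : Measure X) (Ω : Set X) (u : X → ℝ) : Prop :=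
  IntegrableOn u Ω μ ∧ totalVariation μ Ω u < ∞

/-- The norm `‖u‖_{BV(Ω)} = ‖u‖_{L¹(Ω)} + ‖Du‖(Ω)`. -/
noncomputable def bvNorm (μ : Measure X) (Ω : Set X) (u : X → ℝ) : ℝ≥0∞ :=
  ∫⁻ x in Ω, ‖u x‖ₑ ∂μ + totalVariation μ Ω u

variable [BorelSpace X]

/-- `Tu` is the trace of `u` on `∂Ω`; only the values of `u` in `Ω` and of `Tu` on `∂Ω` matter. -/
def IsTrace (μ : Measure X) (Ω : Set X) (u Tu : X → ℝ) : Prop :=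
  ∀ᵐ x ∂(hausdorff μ).restrict (frontier Ω),
    Tendsto (fun r : ℝ => ⨍⁻ y in Ω ∩ Metric.ball x r, ‖u y - Tu x‖ₑ ∂μ) (𝓝[>] 0) (𝓝 0)

/-- The `L¹` trace estimate with constant `CT`: every `u ∈ BV(Ω)` has a trace `Tu`, and
`∫_{∂Ω} |Tu| dH ≤ CT ‖u‖_{BV(Ω)}`. -/
def TraceEstimate (μ : Measure X) (Ω : Set X) (CT : ℝ) : Prop :=
  ∀ u : X → ℝ, MemBV μ Ω u → ∃ Tu : X → ℝ, IsTrace μ Ω u Tu ∧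
    ∫⁻ x in frontier Ω, ‖Tu x‖ₑ ∂(hausdorff μ) ≤ ENNReal.ofReal CT * bvNorm μ Ω u

end BV

end MetricBV

/-! Test the trace estimate with the cutoff `u` that is 1 on B(x,r), vanishes off B(x,2r) and is
1/r-Lipschitz. Its L¹ norm is at most μ(B(x,2r)) and its total variation at most μ(B(x,2r))/r, while
its trace is 1 on B(x,r) ∩ ∂Ω. Hence H(B(x,r) ∩ ∂Ω) ≤ C_T (1 + 1/r) μ(B(x,2r)), and doubling
together with r < 2 diam Ω gives the claim.

Two points need work. The gradient must live on the support of `u`, or its integral would see all of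
Ω: `isUpperGradient_indicator_of_lipschitzWith` shows that a curve pays only for the time it spends
where `u` is positive. And the trace, given only by averages over Ω, must be identified with `u` on
∂Ω: this is `IsTrace.ae_eq_of_continuous`. -/

namespace MetricBV

/-! ### Upper gradients of nonnegative Lipschitz functions -/

section Curves

variable {X : Type*} [MetricSpace X]

/-- The arc-length parametrization is `1`-Lipschitz on the set of attained arc lengths. -/
theorem lipschitzOnWith_naturalParameterization {γ : ℝ → X} {s : Set ℝ} {a : ℝ}
    (hγ : LocallyBoundedVariationOn γ s) (ha : a ∈ s) :
    LipschitzOnWith 1 (naturalParameterization γ s a) (variationOnFromTo γ s a '' s) := by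
  have hspeed := has_unit_speed_naturalParameterization γ hγ ha
  have key : ∀ p ∈ variationOnFromTo γ s a '' s, ∀ q ∈ variationOnFromTo γ s a '' s, p ≤ q →
      edist (naturalParameterization γ s a p) (naturalParameterization γ s a q) ≤ edist p q := by
    intro p hp q hq hpq
    refine (eVariationOn.edist_le (s := variationOnFromTo γ s a '' s ∩ Icc p q) _
      ⟨hp, le_rfl, hpq⟩ ⟨hq, hpq, le_rfl⟩).trans ?_
    rw [hspeed hp hq, edist_dist, Real.dist_eq, abs_sub_comm, abs_of_nonneg (sub_nonneg.2 hpq)]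
    simp
  intro p hp q hq
  rw [ENNReal.coe_one, one_mul]
  rcases le_total p q with h | h
  · exact key p hp q hq h
  · rw [edist_comm, edist_comm p]
    exact key q hq p hp h

variable [MeasurableSpace X] [BorelSpace X]

/-- A nonnegative `K`-Lipschitz function has the upper gradient `K` on its support and `0`
elsewhere. -/
theorem isUpperGradient_indicator_of_lipschitzWith (Ω : Set X) {v : X → ℝ} {K : ℝ≥0}
    (hv : LipschitzWith K v) (hnonneg : ∀ y, 0 ≤ v y) :
    IsUpperGradient Ω v ({y | 0 < v y}.indicator fun _ => (K : ℝ≥0∞)) := by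
  have hopen : IsOpen {y | 0 < v y} := isOpen_lt continuous_const hv.continuous
  refine ⟨measurable_const.indicator hopen.measurableSet, ?_⟩
  rintro γ a b ⟨hab, hcont, hbv, -⟩
  have ha : a ∈ Icc a b := left_mem_Icc.2 hab
  have hb : b ∈ Icc a b := right_mem_Icc.2 hab
  have hloc : LocallyBoundedVariationOn γ (Icc a b) := hbv.locallyBoundedVariationOn
  have hnat : ∀ t ∈ Icc a b, naturalParameterization γ (Icc a b) a
      (variationOnFromTo γ (Icc a b) a t) = γ t := fun t ht =>
    edist_eq_zero.1 (edist_naturalParameterization_eq_zero hloc ha ht)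
  have hmono : MonotoneOn (variationOnFromTo γ (Icc a b) a) (Icc a b) :=
    variationOnFromTo.monotoneOn hloc ha
  have hlip := lipschitzOnWith_naturalParameterization hloc ha
  set V := variationOnFromTo γ (Icc a b) a with hV
  set N := naturalParameterization γ (Icc a b) a with hN
  -- Only attained arc lengths matter: there `N` is 1-Lipschitz and retraces `γ`. For a lower bound
  -- on the curve integral it is enough that `S` is a Borel subset of [0, ℓ(γ)].
  set S : Set ℝ := V '' Icc a b with hS
  have hSsub : S ⊆ Icc 0 (V b) := by
    rintro _ ⟨t, ht, rfl⟩
    refine ⟨?_, hmono ht hb ht.2⟩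
    have := hmono ha ht ht.1
    rwa [hV, variationOnFromTo.self] at this
  have hSmeas : MeasurableSet S := measurableSet_Icc.image_of_monotoneOn hmono
  obtain ⟨O, hO, hOeq⟩ := continuousOn_iff'.1 hlip.continuousOn _ hopen
  have hTmeas : MeasurableSet (O ∩ S) := hO.measurableSet.inter hSmeas
  have hpos : ∀ s ∈ O ∩ S, 0 < v (N s) := fun s hs => by
    rw [← hOeq] at hs
    exact hs.1
  -- Omitting the smaller end value makes every `c` here strictly positive, so the intermediate
  -- value theorem finds it at a point of the curve where `v` is positive.
  have himage : uIoc (v (γ a)) (v (γ b)) ⊆ (v ∘ N) '' (O ∩ S) := by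
    intro c hc
    have hivt := intermediate_value_uIcc (a := a) (b := b) (f := v ∘ γ)
      (by rw [uIcc_of_le hab]; exact hv.continuous.comp_continuousOn hcont)
    obtain ⟨t, ht, rfl⟩ := hivt (uIoc_subset_uIcc hc)
    rw [uIcc_of_le hab] at ht
    have hct : 0 < v (γ t) := lt_of_le_of_lt (le_min (hnonneg _) (hnonneg _)) hc.1
    refine ⟨V t, ?_, congrArg v (hnat t ht)⟩
    rw [← hOeq]
    exact ⟨by simpa [hnat t ht] using hct, mem_image_of_mem V ht⟩
  have hcomp : LipschitzOnWith K (v ∘ N) (O ∩ S) := by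
    simpa using (hv.lipschitzOnWith (s := univ)).comp (hlip.mono inter_subset_right)
      (mapsTo_univ _ _)
  -- On the line, Lebesgue measure is the one-dimensional Hausdorff measure, which a `K`-Lipschitz
  -- map enlarges by at most the factor `K`.
  have hvol : volume ((v ∘ N) '' (O ∩ S)) ≤ K * volume (O ∩ S) := by
    simpa [hausdorffMeasure_real] using
      hcomp.hausdorffMeasure_image_le zero_le_one
  calc ENNReal.ofReal |v (γ a) - v (γ b)|
      = volume (uIoc (v (γ a)) (v (γ b))) := by rw [Real.volume_uIoc, abs_sub_comm]
    _ ≤ volume ((v ∘ N) '' (O ∩ S)) := measure_mono himage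
    _ ≤ K * volume (O ∩ S) := hvol
    _ = ∫⁻ _ in O ∩ S, (K : ℝ≥0∞) := (setLIntegral_const _ _).symm
    _ ≤ ∫⁻ s in O ∩ S, {y | 0 < v y}.indicator (fun _ => (K : ℝ≥0∞)) (N s) :=
        setLIntegral_mono' hTmeas fun s hs =>
          (indicator_of_mem (s := {y | 0 < v y}) (hpos s hs) fun _ => (K : ℝ≥0∞)).ge
    _ ≤ curveIntegral ({y | 0 < v y}.indicator fun _ => (K : ℝ≥0∞)) γ a b :=
        lintegral_mono_set (inter_subset_right.trans hSsub)

/-- The total variation of a nonnegative `K`-Lipschitz function is at most `K` times the measure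
of its support. -/
theorem totalVariation_le_of_lipschitzWith (μ : Measure X) (Ω : Set X) {v : X → ℝ} {K : ℝ≥0}
    (hv : LipschitzWith K v) (hnonneg : ∀ y, 0 ≤ v y) :
    totalVariation μ Ω v ≤ K * μ {y | 0 < v y} := by
  have hmeas : MeasurableSet {y | 0 < v y} :=
    (isOpen_lt continuous_const hv.continuous).measurableSet
  -- The constant sequence `v` competes in the infimum.
  refine (iInf₂_le (fun _ => v) fun _ => {y | 0 < v y}.indicator fun _ => (K : ℝ≥0∞)).trans ?_
  refine (iInf₂_le (fun _ U _ => ⟨K, hv.lipschitzOnWith⟩)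
    fun _ => isUpperGradient_indicator_of_lipschitzWith Ω hv hnonneg).trans ?_
  refine (iInf_le _ fun U _ => by simp).trans ?_
  rw [liminf_const]
  refine (setLIntegral_le_lintegral _ _).trans ?_
  rw [lintegral_indicator hmeas, setLIntegral_const]

end Curves

/-! ### Traces of continuous functions -/

section Trace

variable {X : Type*} [MetricSpace X] [MeasurableSpace X]

theorem IsDoublingWith.measure_ball_pos {μ : Measure X} {Cd : ℝ} (h : IsDoublingWith μ Cd)
    (x : X) {r : ℝ} (hr : 0 < r) : 0 < μ (Metric.ball x r) := by
  simpa only [mul_div_cancel₀ r (two_ne_zero' ℝ)] using (h x (r / 2) (half_pos hr)).1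

theorem IsDoublingWith.measure_ball_lt_top {μ : Measure X} {Cd : ℝ} (h : IsDoublingWith μ Cd)
    (x : X) {r : ℝ} (hr : 0 < r) : μ (Metric.ball x r) < ∞ := by
  have h' := h x (r / 2) (half_pos hr)
  simpa only [mul_div_cancel₀ r (two_ne_zero' ℝ)] using h'.2.1.trans_lt h'.2.2

variable [BorelSpace X]

/-- A continuous function agrees with its trace almost everywhere on the boundary. -/
theorem IsTrace.ae_eq_of_continuous {μ : Measure X} {Cd : ℝ} (hμ : IsDoublingWith μ Cd)
    {Ω : Set X} (hΩ : IsOpen Ω) {u Tu : X → ℝ} (hT : IsTrace μ Ω u Tu) (hu : Continuous u) :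
    ∀ᵐ x ∂(hausdorff μ).restrict (frontier Ω), Tu x = u x := by
  filter_upwards [hT, ae_restrict_mem isClosed_frontier.measurableSet] with x hx hxΩ
  have hbound : ∀ ε : ℝ, 0 < ε → ∀ᶠ r : ℝ in 𝓝[>] 0, ‖u x - Tu x‖ₑ ≤
      ENNReal.ofReal ε + ⨍⁻ y in Ω ∩ Metric.ball x r, ‖u y - Tu x‖ₑ ∂μ := by
    intro ε hε
    obtain ⟨δ, hδ, hclose⟩ := Metric.continuous_iff.1 hu x ε hε
    filter_upwards [Ioo_mem_nhdsGT hδ] with r hr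
    have hopen : IsOpen (Ω ∩ Metric.ball x r) := hΩ.inter Metric.isOpen_ball
    -- A boundary point is a limit of points of Ω, so this open set contains a ball. Positive finite
    -- measure makes the average of a constant equal to that constant.
    have hpos : μ (Ω ∩ Metric.ball x r) ≠ 0 := by
      obtain ⟨z, hz, hzΩ⟩ := mem_closure_iff_nhds.1 (frontier_subset_closure hxΩ) _
        (Metric.ball_mem_nhds x hr.1)
      obtain ⟨ρ, hρ, hsub⟩ := Metric.isOpen_iff.1 hopen z ⟨hzΩ, hz⟩
      exact ((hμ.measure_ball_pos z hρ).trans_le (measure_mono hsub)).ne'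
    have hfin : μ (Ω ∩ Metric.ball x r) ≠ ∞ :=
      ((measure_mono inter_subset_right).trans_lt (hμ.measure_ball_lt_top x hr.1)).ne
    have hle : ⨍⁻ _ in Ω ∩ Metric.ball x r, ‖u x - Tu x‖ₑ ∂μ ≤
        ⨍⁻ y in Ω ∩ Metric.ball x r, (ENNReal.ofReal ε + ‖u y - Tu x‖ₑ) ∂μ := by
      rw [setLAverage_eq, setLAverage_eq]
      gcongr ?_ / _
      refine setLIntegral_mono' hopen.measurableSet fun y hy => ?_
      have hsplit : u x - Tu x = -(u y - u x) + (u y - Tu x) := by ring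
      rw [hsplit]
      refine (enorm_add_le _ _).trans ?_
      rw [enorm_neg]
      gcongr
      rw [Real.enorm_eq_ofReal_abs, ← Real.dist_eq]
      exact ENNReal.ofReal_le_ofReal (hclose y (lt_trans hy.2 hr.2)).le
    rw [setLAverage_const hpos hfin] at hle
    refine hle.trans_eq ?_
    rw [setLAverage_eq, lintegral_add_left measurable_const, ENNReal.add_div, ← setLAverage_eq,
      ← setLAverage_eq, setLAverage_const hpos hfin]
  -- Let r → 0 with ε fixed, then let ε → 0.
  have hzero : ‖u x - Tu x‖ₑ = 0 := by
    refine nonpos_iff_eq_zero.1 (ENNReal.le_of_forall_pos_le_add fun ε hε _ => ?_)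
    have hlim := (tendsto_const_nhds (x := ENNReal.ofReal (ε : ℝ))).add hx
    simpa [add_comm] using ge_of_tendsto hlim (hbound ε hε)
  exact (sub_eq_zero.1 (enorm_eq_zero.1 hzero)).symm

end Trace

/-! ### The cutoff of a ball as a test function -/

section Cutoff

variable {X : Type*} [MetricSpace X]

/-- The cutoff function that is `1` on `B(x,r)`, `0` off `B(x,2r)` and linear in between. -/
noncomputable def ballCutoff (x : X) (r : ℝ) (y : X) : ℝ :=
  max 0 (min 1 (2 - r⁻¹ * dist y x))

theorem ballCutoff_nonneg (x : X) (r : ℝ) (y : X) : 0 ≤ ballCutoff x r y := le_max_left _ _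

theorem ballCutoff_le_one (x : X) (r : ℝ) (y : X) : ballCutoff x r y ≤ 1 :=
  max_le zero_le_one (min_le_left _ _)

theorem ballCutoff_of_mem_ball {x : X} {r : ℝ} (hr : 0 < r) {y : X} (hy : y ∈ Metric.ball x r) :
    ballCutoff x r y = 1 := by
  have h : r⁻¹ * dist y x < 1 := by
    rw [inv_mul_lt_iff₀ hr, mul_one]
    exact hy
  rw [ballCutoff, min_eq_left (by linarith), max_eq_right zero_le_one]

theorem ballCutoff_pos_subset {x : X} {r : ℝ} (hr : 0 < r) :
    {y | 0 < ballCutoff x r y} ⊆ Metric.ball x (2 * r) := by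
  intro y hy
  rcases lt_max_iff.1 (show 0 < max 0 (min 1 (2 - r⁻¹ * dist y x)) from hy) with h | h
  · exact absurd h (lt_irrefl 0)
  · have h' := (lt_min_iff.1 h).2
    rw [sub_pos, inv_mul_lt_iff₀ hr] at h'
    rw [Metric.mem_ball]
    linarith

theorem lipschitzWith_ballCutoff (x : X) {r : ℝ} (hr : 0 < r) :
    LipschitzWith (Real.toNNReal r⁻¹) (ballCutoff x r) := by
  refine LipschitzWith.const_max (LipschitzWith.const_min ?_ 1) 0
  refine LipschitzWith.of_dist_le_mul fun y z => ?_
  rw [Real.coe_toNNReal _ (inv_pos.2 hr).le, Real.dist_eq,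
    show 2 - r⁻¹ * dist y x - (2 - r⁻¹ * dist z x) = r⁻¹ * (dist z x - dist y x) by ring,
    abs_mul, abs_of_pos (inv_pos.2 hr), dist_comm y z]
  gcongr
  exact abs_dist_sub_le z y x

variable [MeasurableSpace X] [BorelSpace X]

theorem lintegral_ballCutoff_le (μ : Measure X) (Ω : Set X) (x : X) {r : ℝ} (hr : 0 < r) :
    ∫⁻ y in Ω, ‖ballCutoff x r y‖ₑ ∂μ ≤ μ (Metric.ball x (2 * r)) := by
  refine (setLIntegral_le_lintegral _ _).trans ?_
  rw [← lintegral_indicator_one Metric.isOpen_ball.measurableSet]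
  refine lintegral_mono fun y => ?_
  by_cases hy : y ∈ Metric.ball x (2 * r)
  · rw [indicator_of_mem hy, Real.enorm_of_nonneg (ballCutoff_nonneg x r y)]
    exact ENNReal.ofReal_le_one.2 (ballCutoff_le_one x r y)
  · have h0 : ballCutoff x r y = 0 := le_antisymm
      (not_lt.1 fun h => hy (ballCutoff_pos_subset hr h)) (ballCutoff_nonneg x r y)
    simp [h0]

theorem totalVariation_ballCutoff_le (μ : Measure X) (Ω : Set X) (x : X) {r : ℝ} (hr : 0 < r) :
    totalVariation μ Ω (ballCutoff x r) ≤ ENNReal.ofReal r⁻¹ * μ (Metric.ball x (2 * r)) := by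
  refine (totalVariation_le_of_lipschitzWith μ Ω (lipschitzWith_ballCutoff x hr)
    (ballCutoff_nonneg x r)).trans ?_
  exact mul_le_mul_right (measure_mono (ballCutoff_pos_subset hr)) _

theorem bvNorm_ballCutoff_le (μ : Measure X) (Ω : Set X) (x : X) {r : ℝ} (hr : 0 < r) :
    bvNorm μ Ω (ballCutoff x r) ≤ ENNReal.ofReal (1 + r⁻¹) * μ (Metric.ball x (2 * r)) := by
  rw [ENNReal.ofReal_add zero_le_one (inv_pos.2 hr).le, ENNReal.ofReal_one, add_mul, one_mul]
  exact add_le_add (lintegral_ballCutoff_le μ Ω x hr) (totalVariation_ballCutoff_le μ Ω x hr)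

theorem memBV_ballCutoff {μ : Measure X} {Cd : ℝ} (hμ : IsDoublingWith μ Cd) (Ω : Set X) (x : X)
    {r : ℝ} (hr : 0 < r) : MemBV μ Ω (ballCutoff x r) := by
  have hball := hμ.measure_ball_lt_top x (mul_pos two_pos hr)
  refine ⟨⟨(lipschitzWith_ballCutoff x hr).continuous.measurable.aestronglyMeasurable, ?_⟩, ?_⟩
  · exact (lintegral_ballCutoff_le μ Ω x hr).trans_lt hball
  · exact (totalVariation_ballCutoff_le μ Ω x hr).trans_lt
      (ENNReal.mul_lt_top ENNReal.ofReal_lt_top hball)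

/-- Testing the trace estimate with the cutoff function of a ball. -/
theorem TraceEstimate.hausdorff_ball_inter_frontier_le {μ : Measure X} {Cd CT : ℝ}
    (hμ : IsDoublingWith μ Cd) {Ω : Set X} (hΩ : IsOpen Ω) (hT : TraceEstimate μ Ω CT)
    (x : X) {r : ℝ} (hr : 0 < r) :
    hausdorff μ (Metric.ball x r ∩ frontier Ω) ≤
      ENNReal.ofReal CT * (ENNReal.ofReal (1 + r⁻¹) * μ (Metric.ball x (2 * r))) := by
  obtain ⟨Tu, htrace, hest⟩ := hT _ (memBV_ballCutoff hμ Ω x hr)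
  have hae := htrace.ae_eq_of_continuous hμ hΩ (lipschitzWith_ballCutoff x hr).continuous
  have hmeas : MeasurableSet (Metric.ball x r) := Metric.isOpen_ball.measurableSet
  refine le_trans ?_ (hest.trans (mul_le_mul_right (bvNorm_ballCutoff_le μ Ω x hr) _))
  rw [← Measure.restrict_apply hmeas, ← lintegral_indicator_one hmeas]
  -- Almost everywhere on ∂Ω the trace is the cutoff, so |Tu| dominates the indicator of the ball;
  -- no measurability of `Tu` is needed.
  refine lintegral_mono_ae ?_
  filter_upwards [hae] with y hy
  by_cases hyB : y ∈ Metric.ball x r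
  · simp [hyB, hy, ballCutoff_of_mem_ball hr hyB]
  · simp [hyB]

end Cutoff

end MetricBV

/-! ### The proposition, by doubling -/

theorem mainTheorem8 (CT Cd D : ℝ) (hCT : 0 < CT) (hCd : 0 < Cd) :
    ∃ C : ℝ, 0 < C ∧
      ∀ (X : Type*) [MetricSpace X] [CompleteSpace X] [MeasurableSpace X] [BorelSpace X]
        (μ : Measure X) (Ω : Set X),
        MetricBV.IsDoublingWith μ Cd → IsOpen Ω → Bornology.IsBounded Ω → Metric.diam Ω = D →
        MetricBV.TraceEstimate μ Ω CT →
        ∀ x ∈ frontier Ω, ∀ r : ℝ, 0 < r → r < 2 * Metric.diam Ω →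
          MetricBV.hausdorff μ (Metric.ball x r ∩ frontier Ω) ≤
            ENNReal.ofReal C * (μ (Metric.ball x r) / ENNReal.ofReal r) := by
  -- Since 1 + 1/r = (1 + r)/r and r < 2D, the factor 1 + r is at most 2D + 1. The absolute value
  -- keeps the constant positive for every real `D`, which is fixed before Ω.
  refine ⟨CT * Cd * (2 * |D| + 1), by positivity, ?_⟩
  intro X _ _ _ _ μ Ω hμ hΩ _ hdiam hT x _ r hr hrD
  have hrD' : 1 + r ≤ 2 * |D| + 1 := by
    have := le_abs_self D
    rw [hdiam] at hrD
    linarith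
  have hcoef : CT * ((1 + r⁻¹) * Cd) ≤ CT * Cd * (2 * |D| + 1) * r⁻¹ := by
    have : CT * ((1 + r⁻¹) * Cd) = CT * Cd * (1 + r) * r⁻¹ := by
      field_simp
      ring
    rw [this]
    gcongr
  calc MetricBV.hausdorff μ (Metric.ball x r ∩ frontier Ω)
      ≤ ENNReal.ofReal CT * (ENNReal.ofReal (1 + r⁻¹) * μ (Metric.ball x (2 * r))) :=
        hT.hausdorff_ball_inter_frontier_le hμ hΩ x hr
    _ ≤ ENNReal.ofReal CT *
          (ENNReal.ofReal (1 + r⁻¹) * (ENNReal.ofReal Cd * μ (Metric.ball x r))) := by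
        gcongr
        exact (hμ x r hr).2.1
    _ = ENNReal.ofReal (CT * ((1 + r⁻¹) * Cd)) * μ (Metric.ball x r) := by
        rw [ENNReal.ofReal_mul hCT.le, ENNReal.ofReal_mul (by positivity)]
        ring
    _ ≤ ENNReal.ofReal (CT * Cd * (2 * |D| + 1) * r⁻¹) * μ (Metric.ball x r) := by gcongr
    _ = ENNReal.ofReal (CT * Cd * (2 * |D| + 1)) * (μ (Metric.ball x r) / ENNReal.ofReal r) := by
        rw [ENNReal.ofReal_mul (by positivity), ENNReal.ofReal_inv_of_pos hr, div_eq_mul_inv]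
        ring
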